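/- Let $N\ge 1$ and let $z_1,\dots,z_N$ be independent (not necessarily identically distributed) nonnegative real random variables on a probability space, with cumulative distribution functions $F_n(x)=\Pr(z_n\le x)$. Assume that for each $n$ there are a real number $d_n>0$ and a function $l_n:(0,\infty)\to(0,\infty)$ that is slowly varying at $0$ (that is, $\lim_{x\to0^+} l_n(tx)/l_n(x)=1$ for every $t>0$) such that $F_n(x)=x^{d_n}\,l_n(x)$ for all $x>0$. Let $$z_{\rm c}=\frac1N\Big(\sum_{n=1}^N\sqrt{z_n}\Big)^2$$ be the power gain after equal gain combining, and let $F_{\rm c}(x)=\Pr(z_{\rm c}\le x)$. Then, as $x\to0^+$, $$F_{\rm c}(x)\sim\Big[\Gamma\Big(2\sum_{n=1}^N d_n+1\Big)\Big]^{-1}\ \prod_{n=1}^N\Gamma(2d_n+1)\cdot\prod_{n=1}^N F_n(Nx),$$ meaning that the ratio of the two sides tends to $1$. -/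

import Mathlib

open MeasureTheory ProbabilityTheory Filter Topology

/-- A positive function `l` on `(0, ∞)` is slowly varying at `0` if `l (t x) / l x → 1` as
`x → 0⁺`, for every `t > 0`. Values of `l` outside `(0, ∞)` play no role. -/
def SlowlyVaryingAtZero (l : ℝ → ℝ) : Prop :=
  (∀ x, 0 < x → 0 < l x) ∧
    ∀ t, 0 < t → Tendsto (fun x => l (t * x) / l x) (𝓝[>] 0) (𝓝 1)

/-- Asymptotic equality near the origin: `H₁ x / H₂ x → 1` as `x → 0⁺`. -/
def AsympEqAtZero (H₁ H₂ : ℝ → ℝ) : Prop :=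
  Tendsto (fun x => H₁ x / H₂ x) (𝓝[>] 0) (𝓝 1)

/-- The power gain after equal gain combining of `N` branches with power gains `z n`. -/
noncomputable def egcGain {Ω : Type*} {N : ℕ} (z : Fin N → Ω → ℝ) (ω : Ω) : ℝ :=
  (∑ n, Real.sqrt (z n ω)) ^ 2 / (N : ℝ)

/-- The cumulative distribution function `x ↦ P(X ≤ x)` of a real random variable `X`. -/
noncomputable def cdfOf {Ω : Type*} [MeasurableSpace Ω] (P : Measure Ω) (X : Ω → ℝ) (x : ℝ) : ℝ :=
  cdf (P.map X) x

/-! The gain is at most `x` iff the sum of the `√z n` is at most `√(N x)`, and `√z n` has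
distribution function `y ↦ F_n (y ^ 2)`, regularly varying with index `2 * d n`. So it suffices to
treat sums of independent positive variables, one summand at a time.

For two summands of indices `a`, `b`, conditioning on `X = u y` suggests that `P(X + Y ≤ y) / (F_X y
* F_Y y)` tends to `∫ (1 - u) ^ b d(u ^ a)`, a beta integral (`tendsto_cdfOf_add_div`). To prove it,
cut `(0, y]` into `m` equal cells for `X`: the probability lies between two finite sums, whose
limits are Riemann–Stieltjes sums of that integral. With `m` fixed, pointwise regular variation is
enough. The limit also shows that indices add, so the induction continues and the Gamma factors
telescope. -/

/-! ### The beta integral and its Riemann–Stieltjes sums -/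

lemma intervalIntegrable_rpow_sub_one_mul_one_sub_rpow {a b : ℝ} (ha : 0 < a) (hb : 0 ≤ b)
    (s t : ℝ) :
    IntervalIntegrable (fun u : ℝ => a * u ^ (a - 1) * (1 - u) ^ b) volume s t :=
  ((intervalIntegral.intervalIntegrable_rpow' (by linarith)).const_mul a).mul_continuousOn
    ((continuous_const.sub continuous_id).rpow_const fun _ => Or.inr hb).continuousOn

lemma integral_rpow_sub_one_mul_one_sub_rpow {a b : ℝ} (ha : 0 < a) (hb : 0 ≤ b) :
    ∫ u in (0 : ℝ)..1, a * u ^ (a - 1) * (1 - u) ^ b =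
      Real.Gamma (a + 1) * Real.Gamma (b + 1) / Real.Gamma (a + b + 1) := by
  have h1 := beta_eq_betaIntegralReal a (b + 1) ha (by linarith)
  have h2 : Complex.betaIntegral a ((b + 1 : ℝ) : ℂ) =
      ((∫ u in (0 : ℝ)..1, u ^ (a - 1) * (1 - u) ^ b : ℝ) : ℂ) := by
    rw [Complex.betaIntegral, ← intervalIntegral.integral_ofReal]
    refine intervalIntegral.integral_congr fun u hu => ?_
    rw [Set.uIcc_of_le zero_le_one] at hu
    rw [Complex.ofReal_mul, Complex.ofReal_cpow hu.1, Complex.ofReal_cpow (by linarith [hu.2])]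
    push_cast
    simp
  rw [h2, Complex.ofReal_re, beta] at h1
  simp_rw [mul_assoc]
  rw [intervalIntegral.integral_const_mul, ← h1, Real.Gamma_add_one ha.ne', ← add_assoc]
  ring

lemma integral_mul_rpow_sub_one {a : ℝ} (ha : 0 < a) (s t : ℝ) :
    ∫ u in s..t, a * u ^ (a - 1) = t ^ a - s ^ a := by
  rw [intervalIntegral.integral_const_mul, integral_rpow (Or.inl (by linarith))]
  simp only [sub_add_cancel]
  field_simp

/-- The upper Riemann–Stieltjes sum of `∫ (1 - u) ^ b d(u ^ a)` over `[0, 1]`, for the partition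
into `m` intervals of equal length. -/
noncomputable def betaUpperSum (a b : ℝ) (m : ℕ) : ℝ :=
  ∑ k ∈ Finset.range m, ((((k + 1 : ℕ) : ℝ) / m) ^ a - ((k : ℝ) / m) ^ a) * (1 - (k : ℝ) / m) ^ b

/-- The lower Riemann–Stieltjes sum of `∫ (1 - u) ^ b d(u ^ a)` over `[0, 1]`, for the partition
into `m` intervals of equal length. -/
noncomputable def betaLowerSum (a b : ℝ) (m : ℕ) : ℝ :=
  ∑ k ∈ Finset.range m,
    ((((k + 1 : ℕ) : ℝ) / m) ^ a - ((k : ℝ) / m) ^ a) * (1 - ((k + 1 : ℕ) : ℝ) / m) ^ b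

/-- Since `(1 - u) ^ b` is nonincreasing on `[0, 1]`, its endpoint values on each cell bound the
integral against `d(u ^ a) = a * u ^ (a - 1) du`. -/
lemma betaLowerSum_le_and_le_betaUpperSum {a b : ℝ} (ha : 0 < a) (hb : 0 ≤ b) {m : ℕ}
    (hm : 0 < m) :
    betaLowerSum a b m ≤ Real.Gamma (a + 1) * Real.Gamma (b + 1) / Real.Gamma (a + b + 1) ∧
      Real.Gamma (a + 1) * Real.Gamma (b + 1) / Real.Gamma (a + b + 1) ≤ betaUpperSum a b m := by
  have hm' : (0 : ℝ) < m := by exact_mod_cast hm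
  have hsum := intervalIntegral.sum_integral_adjacent_intervals (μ := volume)
    (f := fun u : ℝ => a * u ^ (a - 1) * (1 - u) ^ b) (a := fun k : ℕ => (k : ℝ) / m) (n := m)
    fun k _ => intervalIntegrable_rpow_sub_one_mul_one_sub_rpow ha hb _ _
  simp only [Nat.cast_zero, zero_div, div_self hm'.ne'] at hsum
  rw [integral_rpow_sub_one_mul_one_sub_rpow ha hb] at hsum
  rw [← hsum]
  have hi : ∀ (s t c : ℝ), IntervalIntegrable (fun u : ℝ => a * u ^ (a - 1) * c) volume s t :=
    fun s t c => ((intervalIntegral.intervalIntegrable_rpow' (by linarith)).const_mul a).mul_const c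
  have key : ∀ k ∈ Finset.range m, (k : ℝ) / m ≤ ((k + 1 : ℕ) : ℝ) / m ∧ 0 ≤ (k : ℝ) / m ∧
      ((k + 1 : ℕ) : ℝ) / m ≤ 1 := fun k hk => by
    refine ⟨by gcongr; simp, by positivity, ?_⟩
    rw [div_le_one hm']
    exact_mod_cast Finset.mem_range.mp hk
  constructor <;> refine Finset.sum_le_sum fun k hk => ?_ <;> obtain ⟨h1, h2, h3⟩ := key k hk <;>
    rw [← integral_mul_rpow_sub_one ha, ← intervalIntegral.integral_mul_const]
  · refine intervalIntegral.integral_mono_on h1 (hi _ _ _)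
      (intervalIntegrable_rpow_sub_one_mul_one_sub_rpow ha hb _ _) fun u hu => ?_
    have hu0 : 0 ≤ u := h2.trans hu.1
    exact mul_le_mul_of_nonneg_left
      (Real.rpow_le_rpow (by linarith) (by linarith [hu.2]) hb) (by positivity)
  · refine intervalIntegral.integral_mono_on h1
      (intervalIntegrable_rpow_sub_one_mul_one_sub_rpow ha hb _ _) (hi _ _ _) fun u hu => ?_
    have hu0 : 0 ≤ u := h2.trans hu.1
    exact mul_le_mul_of_nonneg_left
      (Real.rpow_le_rpow (by linarith [hu.2]) (by linarith [hu.1]) hb) (by positivity)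

lemma exists_betaUpperSum_sub_betaLowerSum_le {a b : ℝ} (ha : 0 < a) (hb : 0 ≤ b) {ε : ℝ}
    (hε : 0 < ε) : ∃ m : ℕ, 0 < m ∧ betaUpperSum a b m - betaLowerSum a b m ≤ ε := by
  have hc : ContinuousOn (fun u : ℝ => (1 - u) ^ b) (Set.Icc 0 1) :=
    ((continuous_const.sub continuous_id).rpow_const fun _ => Or.inr hb).continuousOn
  obtain ⟨δ, hδ, h⟩ := Metric.uniformContinuousOn_iff.mp
    (isCompact_Icc.uniformContinuousOn_of_continuous hc) ε hε
  obtain ⟨n, hn⟩ := exists_nat_one_div_lt hδ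
  refine ⟨n + 1, n.succ_pos, ?_⟩
  set m := n + 1 with hmdef
  have hm' : (0 : ℝ) < m := by positivity
  have key : ∀ k ∈ Finset.range m, (k : ℝ) / m ≤ ((k + 1 : ℕ) : ℝ) / m ∧ 0 ≤ (k : ℝ) / m ∧
      ((k + 1 : ℕ) : ℝ) / m ≤ 1 := fun k hk => by
    refine ⟨by gcongr; simp, by positivity, ?_⟩
    rw [div_le_one hm']
    exact_mod_cast Finset.mem_range.mp hk
  -- By uniform continuity the endpoint values differ by less than `ε` on each cell; the weights
  -- telescope to `1`.
  calc betaUpperSum a b m - betaLowerSum a b m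
      ≤ ∑ k ∈ Finset.range m, ((((k + 1 : ℕ) : ℝ) / m) ^ a - ((k : ℝ) / m) ^ a) * ε := by
        rw [betaUpperSum, betaLowerSum, ← Finset.sum_sub_distrib]
        refine Finset.sum_le_sum fun k hk => ?_
        obtain ⟨h1, h2, h3⟩ := key k hk
        rw [← mul_sub]
        refine mul_le_mul_of_nonneg_left ?_ (sub_nonneg.mpr (Real.rpow_le_rpow h2 h1 ha.le))
        have hd := h ((k : ℝ) / m) ⟨h2, h1.trans h3⟩ (((k + 1 : ℕ) : ℝ) / m) ⟨h2.trans h1, h3⟩ (by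
          rw [dist_comm, Real.dist_eq, ← sub_div, Nat.cast_succ, add_sub_cancel_left,
            abs_of_pos (by positivity)]
          simpa [hmdef] using hn)
        exact (le_abs_self _).trans hd.le
    _ = ε := by
        rw [← Finset.sum_mul, Finset.sum_range_sub fun k : ℕ => ((k : ℝ) / m) ^ a]
        simp [Real.zero_rpow ha.ne']

/-- A function squeezed between functions whose limits are arbitrarily close to `c`, from below and
from above, tends to `c`. -/
lemma tendsto_of_forall_exists_squeeze {α : Type*} {F : Filter α} {R : α → ℝ} {c : ℝ}
    (h : ∀ ε > 0, ∃ (L U : α → ℝ) (p q : ℝ), Tendsto L F (𝓝 p) ∧ Tendsto U F (𝓝 q) ∧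
      (∀ᶠ y in F, L y ≤ R y ∧ R y ≤ U y) ∧ p ≤ c ∧ c ≤ q ∧ q - p ≤ ε) :
    Tendsto R F (𝓝 c) := by
  rw [Metric.tendsto_nhds]
  intro ε hε
  obtain ⟨L, U, p, q, hL, hU, hLU, hp, hq, hpq⟩ := h (ε / 2) (by positivity)
  filter_upwards [hLU, hL.eventually_const_lt (show p - ε / 2 < p by linarith),
    hU.eventually_lt_const (show q < q + ε / 2 by linarith)] with y hy hy1 hy2
  rw [Real.dist_eq, abs_lt]
  constructor <;> linarith [hy.1, hy.2]

/-! ### Regular variation at the origin -/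

/-- `G` is positive on `(0, ∞)` and varies regularly at `0` with index `a`; the value `t = 0` is
included in the limit, so that `G 0 = 0` if `a ≠ 0`. -/
structure RegVaryingAtZero (G : ℝ → ℝ) (a : ℝ) : Prop where
  pos : ∀ y, 0 < y → 0 < G y
  tendsto : ∀ t, 0 ≤ t → Tendsto (fun y => G (t * y) / G y) (𝓝[>] 0) (𝓝 (t ^ a))

lemma tendsto_const_mul_nhdsGT_zero {t : ℝ} (ht : 0 < t) :
    Tendsto (fun y : ℝ => t * y) (𝓝[>] 0) (𝓝[>] 0) := by
  refine tendsto_nhdsWithin_iff.mpr ⟨?_, ?_⟩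
  · have : Tendsto (fun y : ℝ => t * y) (𝓝 0) (𝓝 (t * 0)) :=
      (continuous_const.mul continuous_id).tendsto 0
    rw [mul_zero] at this
    exact this.mono_left nhdsWithin_le_nhds
  · filter_upwards [self_mem_nhdsWithin] with y hy
    exact mul_pos ht hy

/-- A distribution function that varies regularly at `0` with positive index vanishes at `0`. -/
lemma cdfOf_zero_eq_zero {Ω : Type*} [MeasurableSpace Ω] {P : Measure Ω} {X : Ω → ℝ} {d : ℝ}
    (hd : 0 < d) {l : ℝ → ℝ} (hl : SlowlyVaryingAtZero l)
    (hF : ∀ x, 0 < x → cdfOf P X x = x ^ d * l x) : cdfOf P X 0 = 0 := by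
  by_contra h0
  have hright : Tendsto (cdfOf P X) (𝓝[>] 0) (𝓝 (cdfOf P X 0)) :=
    ((cdf (P.map X)).right_continuous 0).mono_left (nhdsWithin_mono _ Set.Ioi_subset_Ici_self)
  -- An atom at `0` would make this ratio tend to `1` by right continuity, whereas regular variation
  -- gives `(1 / 2) ^ d < 1`.
  have h1 : Tendsto (fun x => cdfOf P X (1 / 2 * x) / cdfOf P X x) (𝓝[>] 0) (𝓝 1) := by
    have := (hright.comp (tendsto_const_mul_nhdsGT_zero (t := 1 / 2) (by norm_num))).div hright h0
    rwa [div_self h0] at this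
  have h2 : Tendsto (fun x => cdfOf P X (1 / 2 * x) / cdfOf P X x) (𝓝[>] 0)
      (𝓝 ((1 / 2) ^ d * 1)) := by
    refine ((hl.2 (1 / 2) (by norm_num)).const_mul _).congr' ?_
    filter_upwards [self_mem_nhdsWithin] with x hx
    have hx' : (0 : ℝ) < x := hx
    rw [hF x hx', hF _ (by positivity), Real.mul_rpow (by norm_num) hx'.le]
    have := hl.1 x hx'
    field_simp
  have h3 := tendsto_nhds_unique h1 h2
  have h4 : ((1 : ℝ) / 2) ^ d < 1 := Real.rpow_lt_one (by norm_num) (by norm_num) hd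
  linarith

/-! ### Sums of independent variables -/

section Cdf

variable {Ω : Type*} [MeasurableSpace Ω] {P : Measure Ω} [IsProbabilityMeasure P] {X Y : Ω → ℝ}

lemma cdfOf_eq_measureReal (hX : AEMeasurable X P) (x : ℝ) :
    cdfOf P X x = P.real (X ⁻¹' Set.Iic x) := by
  have := Measure.isProbabilityMeasure_map hX
  rw [cdfOf, cdf_eq_real, measureReal_def, measureReal_def,
    Measure.map_apply_of_aemeasurable hX measurableSet_Iic]

lemma measureReal_preimage_Ioc_inter_preimage_Iic (hX : AEMeasurable X P) (hY : AEMeasurable Y P)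
    (hXY : IndepFun X Y P) {s t : ℝ} (hst : s ≤ t) (r : ℝ) :
    P.real (X ⁻¹' Set.Ioc s t ∩ Y ⁻¹' Set.Iic r) =
      (cdfOf P X t - cdfOf P X s) * cdfOf P Y r := by
  have hsub : X ⁻¹' Set.Iic s ⊆ X ⁻¹' Set.Iic t :=
    Set.preimage_mono (Set.Iic_subset_Iic.mpr hst)
  rw [measureReal_def, hXY.measure_inter_preimage_eq_mul _ _ measurableSet_Ioc measurableSet_Iic,
    ENNReal.toReal_mul, cdfOf_eq_measureReal hX, cdfOf_eq_measureReal hX, cdfOf_eq_measureReal hY,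
    ← measureReal_def, ← measureReal_def, ← Set.Iic_sdiff_Iic, Set.preimage_sdiff,
    measureReal_def, measure_sdiff hsub (hX.nullMeasurableSet_preimage measurableSet_Iic)
      (measure_ne_top _ _), ENNReal.toReal_sub_of_le (measure_mono hsub) (measure_ne_top _ _),
    ← measureReal_def, ← measureReal_def]

lemma cdfOf_mul_cdfOf_le_cdfOf_add (hX : AEMeasurable X P) (hY : AEMeasurable Y P)
    (hXY : IndepFun X Y P) (x y : ℝ) :
    cdfOf P X x * cdfOf P Y y ≤ cdfOf P (X + Y) (x + y) := by
  rw [cdfOf_eq_measureReal hX, cdfOf_eq_measureReal hY, cdfOf_eq_measureReal (hX.add hY),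
    measureReal_def, measureReal_def, ← ENNReal.toReal_mul,
    ← hXY.measure_inter_preimage_eq_mul _ _ measurableSet_Iic measurableSet_Iic, ← measureReal_def]
  refine measureReal_mono fun ω h => ?_
  change X ω + Y ω ≤ x + y
  exact add_le_add h.1 h.2

lemma sum_le_cdfOf_add (hX : AEMeasurable X P) (hY : AEMeasurable Y P) (hXY : IndepFun X Y P)
    {m : ℕ} (hm : 0 < m) {y : ℝ} (hy : 0 < y) :
    ∑ k ∈ Finset.range m, (cdfOf P X (((k + 1 : ℕ) : ℝ) / m * y) - cdfOf P X ((k : ℝ) / m * y)) *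
      cdfOf P Y ((1 - ((k + 1 : ℕ) : ℝ) / m) * y) ≤ cdfOf P (X + Y) y := by
  have hm' : (0 : ℝ) < m := by exact_mod_cast hm
  have hmono : Monotone fun k : ℕ => (k : ℝ) / m * y := fun i j hij => by
    simp only
    gcongr
  rw [Finset.sum_congr rfl fun k _ => (measureReal_preimage_Ioc_inter_preimage_Iic hX hY hXY
      (hmono k.le_succ) ((1 - ((k + 1 : ℕ) : ℝ) / m) * y)).symm,
    cdfOf_eq_measureReal (hX.add hY), ← measureReal_biUnion_finset₀]
  · refine measureReal_mono (Set.iUnion₂_subset fun k _ ω h => ?_)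
    have h1 : X ω ≤ ((k + 1 : ℕ) : ℝ) / m * y := h.1.2
    have h2 : Y ω ≤ (1 - ((k + 1 : ℕ) : ℝ) / m) * y := h.2
    change X ω + Y ω ≤ y
    linarith
  · intro i _ j _ hij
    exact Disjoint.aedisjoint <| ((hmono.pairwise_disjoint_on_Ioc_succ hij).preimage X).mono
      Set.inter_subset_left Set.inter_subset_left
  · exact fun k _ => (hX.nullMeasurableSet_preimage measurableSet_Ioc).inter
      (hY.nullMeasurableSet_preimage measurableSet_Iic)

lemma cdfOf_add_le_sum (hX : AEMeasurable X P) (hY : AEMeasurable Y P) (hXY : IndepFun X Y P)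
    (hX0 : ∀ᵐ ω ∂P, 0 < X ω) (hY0 : ∀ᵐ ω ∂P, 0 ≤ Y ω) {m : ℕ} (hm : 0 < m) {y : ℝ} (hy : 0 < y) :
    cdfOf P (X + Y) y ≤
      ∑ k ∈ Finset.range m, (cdfOf P X (((k + 1 : ℕ) : ℝ) / m * y) - cdfOf P X ((k : ℝ) / m * y)) *
        cdfOf P Y ((1 - (k : ℝ) / m) * y) := by
  have hm' : (0 : ℝ) < m := by exact_mod_cast hm
  have hmono : Monotone fun k : ℕ => (k : ℝ) / m * y := fun i j hij => by
    simp only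
    gcongr
  rw [Finset.sum_congr rfl fun k _ => (measureReal_preimage_Ioc_inter_preimage_Iic hX hY hXY
      (hmono (Nat.le_succ k)) ((1 - ((k : ℕ) : ℝ) / m) * y)).symm, cdfOf_eq_measureReal (hX.add hY)]
  refine le_trans ?_ (measureReal_biUnion_finset_le _ _)
  refine ENNReal.toReal_mono (measure_ne_top _ _) (measure_mono_ae ?_)
  filter_upwards [hX0, hY0] with ω hx hy0 h
  have hxy : X ω + Y ω ≤ y := h
  -- The cells are open on the left, so the cell of `X ω` is found by a ceiling, nonzero because `X
  -- ω > 0`.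
  obtain ⟨k, hk⟩ : ∃ k, ⌈X ω / y * m⌉₊ = k + 1 :=
    Nat.exists_eq_succ_of_ne_zero (Nat.ceil_pos.mpr (by positivity)).ne'
  have h1 : X ω / y * m ≤ ((k + 1 : ℕ) : ℝ) := Nat.ceil_le.mp hk.le
  have h2 : (k : ℝ) < X ω / y * m := Nat.lt_ceil.mp (by omega)
  have h3 : k < m := by
    have : X ω / y * m ≤ 1 * m := by
      gcongr
      rw [div_le_one hy]
      linarith
    exact_mod_cast h2.trans_le (this.trans_eq (one_mul _))
  have h4 : (k : ℝ) / m * y < X ω := by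
    rwa [← lt_div_iff₀ hy, div_lt_iff₀ hm']
  refine Set.mem_iUnion₂.mpr ⟨k, Finset.mem_range.mpr h3, ⟨h4, ?_⟩, ?_⟩
  · change X ω ≤ _
    rwa [← div_le_iff₀ hy, le_div_iff₀ hm']
  · change Y ω ≤ _
    linarith

/-- The distribution function of a sum of two independent nonnegative variables with regularly
varying distribution functions is, up to a beta factor, the product of these functions. -/
theorem tendsto_cdfOf_add_div (hX : AEMeasurable X P) (hY : AEMeasurable Y P)
    (hXY : IndepFun X Y P) (hX0 : ∀ᵐ ω ∂P, 0 < X ω) (hY0 : ∀ᵐ ω ∂P, 0 ≤ Y ω)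
    {a b : ℝ} (ha : 0 < a) (hb : 0 ≤ b)
    (hXa : RegVaryingAtZero (cdfOf P X) a) (hYb : RegVaryingAtZero (cdfOf P Y) b) :
    Tendsto (fun y => cdfOf P (X + Y) y / (cdfOf P X y * cdfOf P Y y)) (𝓝[>] 0)
      (𝓝 (Real.Gamma (a + 1) * Real.Gamma (b + 1) / Real.Gamma (a + b + 1))) := by
  refine tendsto_of_forall_exists_squeeze fun ε hε => ?_
  obtain ⟨m, hm, hmε⟩ := exists_betaUpperSum_sub_betaLowerSum_le ha hb hε
  have hm' : (0 : ℝ) < m := by exact_mod_cast hm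
  obtain ⟨hlo, hup⟩ := betaLowerSum_le_and_le_betaUpperSum ha hb hm
  -- Both bounding sums have this form. The argument `0` occurs in the first cell for `X`, and in
  -- the last cell of the lower sum for `Y`.
  have hlim : ∀ r : ℕ → ℝ, (∀ k < m, 0 ≤ r k) → Tendsto (fun y => (∑ k ∈ Finset.range m,
      (cdfOf P X (((k + 1 : ℕ) : ℝ) / m * y) - cdfOf P X ((k : ℝ) / m * y)) *
        cdfOf P Y (r k * y)) / (cdfOf P X y * cdfOf P Y y)) (𝓝[>] 0)
      (𝓝 (∑ k ∈ Finset.range m,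
        ((((k + 1 : ℕ) : ℝ) / m) ^ a - ((k : ℝ) / m) ^ a) * r k ^ b)) := fun r hr => by
    simp_rw [Finset.sum_div, mul_div_mul_comm, sub_div]
    refine tendsto_finsetSum _ fun k hk => Tendsto.mul (Tendsto.sub ?_ ?_) ?_
    · exact hXa.tendsto _ (by positivity)
    · exact hXa.tendsto _ (by positivity)
    · exact hYb.tendsto _ (hr k (Finset.mem_range.mp hk))
  refine ⟨_, _, _, _, hlim (fun k => 1 - ((k + 1 : ℕ) : ℝ) / m) fun k hk => ?_,
    hlim (fun k => 1 - (k : ℝ) / m) fun k hk => ?_, ?_, hlo, hup, hmε⟩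
  · rw [sub_nonneg, div_le_one hm']
    exact_mod_cast hk
  · rw [sub_nonneg, div_le_one hm']
    exact_mod_cast hk.le
  · filter_upwards [self_mem_nhdsWithin] with y hy
    have := hXa.pos y hy
    have := hYb.pos y hy
    constructor
    · gcongr
      exact sum_le_cdfOf_add hX hY hXY hm hy
    · gcongr
      exact cdfOf_add_le_sum hX hY hXY hX0 hY0 hm hy

/-- The indices of regular variation of distribution functions add up under sums of independent
nonnegative variables. -/
theorem RegVaryingAtZero.cdfOf_add (hX : AEMeasurable X P) (hY : AEMeasurable Y P)
    (hXY : IndepFun X Y P) (hX0 : ∀ᵐ ω ∂P, 0 < X ω) (hY0 : ∀ᵐ ω ∂P, 0 ≤ Y ω)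
    {a b : ℝ} (ha : 0 < a) (hb : 0 ≤ b)
    (hXa : RegVaryingAtZero (cdfOf P X) a) (hYb : RegVaryingAtZero (cdfOf P Y) b) :
    RegVaryingAtZero (cdfOf P (X + Y)) (a + b) := by
  have hpos : ∀ y, 0 < y → 0 < cdfOf P (X + Y) y := fun y hy => by
    have h := cdfOf_mul_cdfOf_le_cdfOf_add hX hY hXY (y / 2) (y / 2)
    rw [add_halves] at h
    exact (mul_pos (hXa.pos _ (half_pos hy)) (hYb.pos _ (half_pos hy))).trans_le h
  refine ⟨hpos, fun t ht => ?_⟩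
  rcases ht.eq_or_lt with rfl | ht
  · have h0 : cdfOf P (X + Y) 0 = 0 := by
      rw [cdfOf_eq_measureReal (hX.add hY), measureReal_def, measure_eq_zero_iff_ae_notMem.mpr,
        ENNReal.toReal_zero]
      filter_upwards [hX0, hY0] with ω h1 h2 h3
      have h4 : X ω + Y ω ≤ 0 := h3
      linarith
    simp [h0, Real.zero_rpow (add_pos_of_pos_of_nonneg ha hb).ne']
  · have hc := tendsto_cdfOf_add_div hX hY hXY hX0 hY0 ha hb hXa hYb
    have hc0 : Real.Gamma (a + 1) * Real.Gamma (b + 1) / Real.Gamma (a + b + 1) ≠ 0 := by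
      have := Real.Gamma_pos_of_pos (show 0 < a + 1 by linarith)
      have := Real.Gamma_pos_of_pos (show 0 < b + 1 by linarith)
      have := Real.Gamma_pos_of_pos (show 0 < a + b + 1 by linarith)
      positivity
    -- The beta factors at `t * y` and at `y` cancel in the limit, leaving `t ^ a * t ^ b`.
    have h := ((hc.comp (tendsto_const_mul_nhdsGT_zero ht)).div hc hc0).mul
      ((hXa.tendsto t ht.le).mul (hYb.tendsto t ht.le))
    rw [div_self hc0, one_mul, ← Real.rpow_add ht] at h
    refine h.congr' ?_
    filter_upwards [self_mem_nhdsWithin] with y hy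
    have := hXa.pos y hy
    have := hYb.pos y hy
    have := hXa.pos (t * y) (mul_pos ht hy)
    have := hYb.pos (t * y) (mul_pos ht hy)
    have := hpos y hy
    simp only [Function.comp_def, Pi.div_apply]
    field_simp

/-- The distribution function of a finite sum of independent positive variables with regularly
varying distribution functions. -/
theorem regVaryingAtZero_and_tendsto_cdfOf_sum {ι : Type*} {Y : ι → Ω → ℝ}
    (hY : ∀ i, AEMeasurable (Y i) P) (hind : iIndepFun Y P) (hpos : ∀ i, ∀ᵐ ω ∂P, 0 < Y i ω)
    {a : ι → ℝ} (ha : ∀ i, 0 < a i) (hreg : ∀ i, RegVaryingAtZero (cdfOf P (Y i)) (a i))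
    (s : Finset ι) :
    RegVaryingAtZero (cdfOf P (∑ i ∈ s, Y i)) (∑ i ∈ s, a i) ∧
      Tendsto (fun y => cdfOf P (∑ i ∈ s, Y i) y / ∏ i ∈ s, cdfOf P (Y i) y) (𝓝[>] 0)
        (𝓝 ((∏ i ∈ s, Real.Gamma (a i + 1)) / Real.Gamma (∑ i ∈ s, a i + 1))) := by
  classical
  induction s using Finset.induction_on with
  | empty =>
    -- The empty sum has index `0`, hence the two-variable results allow `b = 0` and a `Y` that may
    -- vanish.
    have h1 : ∀ y, 0 ≤ y → cdfOf P (0 : Ω → ℝ) y = 1 := fun y hy => by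
      rw [cdfOf_eq_measureReal (X := 0) measurable_zero.aemeasurable]
      have : (0 : Ω → ℝ) ⁻¹' Set.Iic y = Set.univ := by
        ext ω
        simpa using hy
      simp [this]
    simp only [Finset.sum_empty, Finset.prod_empty, div_one, zero_add, Real.Gamma_one]
    refine ⟨⟨fun y hy => by simp [h1 y hy.le], fun t ht => ?_⟩, ?_⟩
    · refine tendsto_const_nhds.congr' ?_
      filter_upwards [self_mem_nhdsWithin] with y hy
      have hy' : (0 : ℝ) < y := hy
      simp [h1 y hy'.le, h1 (t * y) (by positivity)]
    · refine tendsto_const_nhds.congr' ?_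
      filter_upwards [self_mem_nhdsWithin] with y hy
      exact (h1 y (le_of_lt hy)).symm
  | insert i s hi ih =>
    obtain ⟨ihreg, ihlim⟩ := ih
    have hS : AEMeasurable (∑ j ∈ s, Y j) P := Finset.aemeasurable_sum _ fun j _ => hY j
    have hiS : IndepFun (Y i) (∑ j ∈ s, Y j) P := (hind.indepFun_finsetSum_of_notMem₀ hY hi).symm
    have hS0 : ∀ᵐ ω ∂P, 0 ≤ (∑ j ∈ s, Y j) ω := by
      filter_upwards [(Finset.eventually_all s).mpr fun j _ => hpos j] with ω hω
      rw [Finset.sum_apply]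
      exact Finset.sum_nonneg fun j hj => (hω j hj).le
    have hb : 0 ≤ ∑ j ∈ s, a j := Finset.sum_nonneg fun j _ => (ha j).le
    rw [Finset.sum_insert hi, Finset.sum_insert hi, Finset.prod_insert hi]
    simp_rw [Finset.prod_insert hi]
    refine ⟨.cdfOf_add (hY i) hS hiS (hpos i) hS0 (ha i) hb (hreg i) ihreg, ?_⟩
    have h := (tendsto_cdfOf_add_div (hY i) hS hiS (hpos i) hS0 (ha i) hb (hreg i) ihreg).mul ihlim
    have hG := Real.Gamma_pos_of_pos (show 0 < ∑ j ∈ s, a j + 1 by linarith)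
    have hlim : Real.Gamma (a i + 1) * Real.Gamma (∑ j ∈ s, a j + 1) /
        Real.Gamma (a i + ∑ j ∈ s, a j + 1) *
          ((∏ j ∈ s, Real.Gamma (a j + 1)) / Real.Gamma (∑ j ∈ s, a j + 1)) =
        (Real.Gamma (a i + 1) * ∏ j ∈ s, Real.Gamma (a j + 1)) /
          Real.Gamma (a i + ∑ j ∈ s, a j + 1) := by
      field_simp
    rw [hlim] at h
    refine h.congr' ?_
    filter_upwards [self_mem_nhdsWithin] with y hy
    have := ihreg.pos y hy
    have := (hreg i).pos y hy
    field_simp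

/-! ### Reduction of the power gain to a sum of square roots -/

lemma cdfOf_sqrt (hX : AEMeasurable X P) {y : ℝ} (hy : 0 ≤ y) :
    cdfOf P (fun ω => Real.sqrt (X ω)) y = cdfOf P X (y ^ 2) := by
  rw [cdfOf_eq_measureReal hX, cdfOf_eq_measureReal hX.sqrt]
  congr 1
  ext ω
  exact Real.sqrt_le_left hy

lemma cdfOf_egcGain {N : ℕ} (hN : 1 ≤ N) {z : Fin N → Ω → ℝ} (hz : ∀ n, AEMeasurable (z n) P)
    {x : ℝ} (hx : 0 ≤ x) :
    cdfOf P (egcGain z) x = cdfOf P (∑ n, fun ω => Real.sqrt (z n ω)) (Real.sqrt (N * x)) := by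
  have hN' : (0 : ℝ) < N := by exact_mod_cast hN
  have hs : AEMeasurable (∑ n, fun ω => Real.sqrt (z n ω)) P :=
    Finset.aemeasurable_sum _ fun n _ => (hz n).sqrt
  have he : AEMeasurable (egcGain z) P := by
    have : egcGain z = fun ω => (∑ n, fun ω => Real.sqrt (z n ω)) ω ^ 2 / (N : ℝ) := by
      ext ω
      simp [egcGain]
    rw [this]
    exact (hs.pow_const 2).div_const _
  rw [cdfOf_eq_measureReal hs, cdfOf_eq_measureReal he]
  congr 1
  ext ω
  simp only [egcGain, Set.mem_preimage, Set.mem_Iic, Finset.sum_apply]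
  rw [div_le_iff₀ hN', mul_comm x, Real.le_sqrt (Finset.sum_nonneg fun n _ => Real.sqrt_nonneg _)
    (by positivity)]

lemma regVaryingAtZero_cdfOf_sqrt (hX : AEMeasurable X P) {d : ℝ} (hd : 0 < d) {l : ℝ → ℝ}
    (hl : SlowlyVaryingAtZero l) (hF : ∀ x, 0 < x → cdfOf P X x = x ^ d * l x) :
    RegVaryingAtZero (cdfOf P fun ω => Real.sqrt (X ω)) (2 * d) := by
  refine ⟨fun y hy => ?_, fun t ht => ?_⟩
  · rw [cdfOf_sqrt hX hy.le, hF _ (by positivity)]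
    have := hl.1 (y ^ 2) (by positivity)
    positivity
  rcases ht.eq_or_lt with rfl | ht
  · have h0 : cdfOf P (fun ω => Real.sqrt (X ω)) 0 = 0 := by
      rw [cdfOf_sqrt hX le_rfl, zero_pow two_ne_zero, cdfOf_zero_eq_zero hd hl hF]
    simp [h0, Real.zero_rpow (mul_pos two_pos hd).ne']
  · have hsq : Tendsto (fun y : ℝ => y ^ 2) (𝓝[>] 0) (𝓝[>] 0) := by
      refine tendsto_nhdsWithin_iff.mpr ⟨?_, ?_⟩
      · have : Tendsto (fun y : ℝ => y ^ 2) (𝓝 0) (𝓝 (0 ^ 2)) := (continuous_pow 2).tendsto 0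
        rw [zero_pow two_ne_zero] at this
        exact this.mono_left nhdsWithin_le_nhds
      · filter_upwards [self_mem_nhdsWithin] with y hy
        exact pow_pos (Set.mem_Ioi.mp hy) 2
    have h := ((hl.2 (t ^ 2) (by positivity)).comp hsq).const_mul ((t ^ 2) ^ d)
    have ht2 : (t ^ 2) ^ d = t ^ (2 * d) := by
      rw [Real.rpow_mul ht.le, Real.rpow_two]
    rw [mul_one, ht2] at h
    refine h.congr' ?_
    filter_upwards [self_mem_nhdsWithin] with y hy
    have hy' : (0 : ℝ) < y := hy
    rw [cdfOf_sqrt hX hy'.le, cdfOf_sqrt hX (by positivity), hF _ (by positivity),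
      hF _ (by positivity), mul_pow, Real.mul_rpow (by positivity) (by positivity), ht2]
    have := hl.1 (y ^ 2) (by positivity)
    simp only [Function.comp]
    field_simp

end Cdf

theorem mainTheorem6 {Ω : Type*} [MeasurableSpace Ω] (P : Measure Ω) [IsProbabilityMeasure P]
    (N : ℕ) (hN : 1 ≤ N) (z : Fin N → Ω → ℝ)
    (hz_meas : ∀ n, AEMeasurable (z n) P)
    (hz_nonneg : ∀ n, ∀ᵐ ω ∂P, 0 ≤ z n ω)
    (hz_indep : iIndepFun z P)
    (d : Fin N → ℝ) (hd : ∀ n, 0 < d n)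
    (l : Fin N → ℝ → ℝ) (hl : ∀ n, SlowlyVaryingAtZero (l n))
    (hF : ∀ n, ∀ x, 0 < x → cdfOf P (z n) x = x ^ d n * l n x) :
    AsympEqAtZero (cdfOf P (egcGain z))
      (fun x => (Real.Gamma (2 * (∑ n, d n) + 1))⁻¹ * (∏ n, Real.Gamma (2 * d n + 1)) *
        ∏ n, cdfOf P (z n) ((N : ℝ) * x)) := by
  have hN' : (0 : ℝ) < N := by exact_mod_cast hN
  have hind : iIndepFun (fun n ω => Real.sqrt (z n ω)) P :=
    hz_indep.comp (fun _ => Real.sqrt) fun _ => Real.continuous_sqrt.measurable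
  -- `F_n 0 = 0` upgrades nonnegativity to almost sure positivity.
  have hpos : ∀ n, ∀ᵐ ω ∂P, 0 < Real.sqrt (z n ω) := fun n => by
    have h0 := cdfOf_zero_eq_zero (hd n) (hl n) (hF n)
    rw [cdfOf_eq_measureReal (hz_meas n), measureReal_eq_zero_iff,
      measure_eq_zero_iff_ae_notMem] at h0
    filter_upwards [h0] with ω hω
    exact Real.sqrt_pos.mpr (not_le.mp hω)
  have hlim := (regVaryingAtZero_and_tendsto_cdfOf_sum (fun n => (hz_meas n).sqrt) hind hpos
    (fun n => mul_pos two_pos (hd n))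
    (fun n => regVaryingAtZero_cdfOf_sqrt (hz_meas n) (hd n) (hl n) (hF n)) Finset.univ).2
  rw [← Finset.mul_sum] at hlim
  have hsqrt : Tendsto (fun x : ℝ => Real.sqrt (N * x)) (𝓝[>] 0) (𝓝[>] 0) := by
    refine tendsto_nhdsWithin_iff.mpr ⟨?_, ?_⟩
    · have h := (Real.continuous_sqrt.tendsto 0).comp
        ((tendsto_const_mul_nhdsGT_zero hN').mono_right nhdsWithin_le_nhds)
      rwa [Real.sqrt_zero] at h
    · filter_upwards [self_mem_nhdsWithin] with x hx
      exact Real.sqrt_pos.mpr (mul_pos hN' hx)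
  have hG : 0 < Real.Gamma (2 * ∑ n, d n + 1) := Real.Gamma_pos_of_pos (by
    have := Finset.sum_nonneg fun n (_ : n ∈ Finset.univ) => (hd n).le
    linarith)
  have hGp : 0 < ∏ n, Real.Gamma (2 * d n + 1) := Finset.prod_pos fun n _ =>
    Real.Gamma_pos_of_pos (by linarith [hd n])
  have hc : (∏ n, Real.Gamma (2 * d n + 1)) / Real.Gamma (2 * ∑ n, d n + 1) ≠ 0 :=
    (div_pos hGp hG).ne'
  have h := (hlim.comp hsqrt).div_const
    ((∏ n, Real.Gamma (2 * d n + 1)) / Real.Gamma (2 * ∑ n, d n + 1))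
  rw [div_self hc] at h
  refine h.congr' ?_
  filter_upwards [self_mem_nhdsWithin] with x hx
  have hx' : (0 : ℝ) < x := hx
  have hNx : 0 ≤ (N : ℝ) * x := by positivity
  simp only [Function.comp]
  rw [cdfOf_egcGain hN hz_meas hx'.le, div_div, mul_comm (∏ n, cdfOf P _ _), inv_mul_eq_div]
  congr 2
  refine Finset.prod_congr rfl fun n _ => ?_
  rw [cdfOf_sqrt (hz_meas n) (Real.sqrt_nonneg _), Real.sq_sqrt hNx]
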